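/- **Setting.** Paulis are taken modulo phase. Let $Q$ be a qubit stabiliser code (in particular, any quantum LDPC code) given by pairwise commuting checks $h_1,\dots,h_r$. Let one or more auxiliary systems be attached to $Q$ by a Clifford circuit on data and auxiliary qubits, consisting of Clifford gates and Pauli measurements. The input is an arbitrary code state of $Q$, together with auxiliary qubits prepared in a stabiliser state (or, more generally, with a fixed set of commuting stabilisers). During a window of time the auxiliary systems act, and $T$ rounds of syndrome measurement take place in this window; in addition the outcomes of auxiliary measurements are recorded. Any number of ordinary syndrome rounds on the idling $Q$ may precede and follow. During the window checks of $Q$ may be deformed onto auxiliary qubits, and data errors may be copied to auxiliary qubits, but the data errors themselves stay in place on $Q$, and the check $i$ of each round, pulled back to the input, acts on the data qubits as $h_i$. The method of measurement (surgery, homomorphic measurement, etc.) is otherwise arbitrary. **Measured representatives.** Suppose that a product of recorded outcomes, possibly together with a stabiliser of $Q$ at the output, equals a logical operator (trivial or not) of the input code state, up to stabilisers of the initial auxiliary state. The product of the data parts (pulled back to the input) of the auxiliary measurements that enter it is then a representative of that logical operator (up to stabilisers of $Q$); call it a *measured representative*. Let $S$ be a set of logical operator representatives measured by the auxiliary systems,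 i.e. the measured representatives are exactly the products of elements of $S$. Assume that the outcomes of $S$ are not known in advance: on an arbitrary code state nothing about them is determined except that equivalent representatives (those that differ by a stabiliser) have equal values. That is, every stabiliser of $Q$ which is a product of elements of $S$ is a product of factors $uv$ with $u,v\in S$ equivalent. (For example, this holds if inequivalent elements of $S$ are independent modulo stabilisers, or if $S$ is closed under products.) **Fault distance.** A phenomenological fault consists of Pauli errors on the qubits before each time step and after the last one, and flips of recorded measurement outcomes; its weight is the number of single-qubit errors plus the number of flipped outcomes. A detector is a product of outcomes, possibly with a stabiliser of $Q$ at the output, whose value is determined in the absence of faults. A logical fault is a fault that flips no detector but flips a logical observable, i.e. a logical measurement outcome or, more generally, a product of outcomes and of a logical operator of $Q$ at the output that equals a logical operator of the input in the absence of faults. The phenomenological fault distance is the minimum weight of a logical fault ($\infty$ if there is none). **Proposition.** Let $f$ be a lowest-weight Pauli fault on the data qubits of $Q$ such that * $f$ flips (anticommutes with) at least one element of $S$; * if $f$ flips an element of $S$, then it flips all elements of $S$ that are equivalent to it. Let $w$ be the weight of $f$, and let $s$ be its syndrome weight, i.e. the number of checks $h_i$ that anticommute with $f$. Then the phenomenological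 fault distance of the protocol is at most $2w+Ts$. -/

import Mathlib

open Finset

/-- Pauli operators on the qubits `ι`, modulo phase: at each qubit a pair `(x, z)`, where
`(0,0), (1,0), (0,1), (1,1)` stand for `I, X, Z, Y`. Addition is multiplication of operators. -/
abbrev Pauli (ι : Type*) : Type _ := ι → ZMod 2 × ZMod 2

namespace Pauli

/-- The symplectic form: `0` if the two operators commute, `1` if they anticommute. -/
def symp {ι : Type*} [Fintype ι] (u v : Pauli ι) : ZMod 2 :=
  ∑ i, ((u i).1 * (v i).2 + (u i).2 * (v i).1)

/-- A Pauli fault flips the value of an operator iff it anticommutes with it. -/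
def Flips {ι : Type*} [Fintype ι] (f u : Pauli ι) : Prop := symp f u = 1

/-- Number of qubits on which the operator acts nontrivially. -/
def weight {ι : Type*} [Fintype ι] (u : Pauli ι) : ℕ := hammingNorm u

/-- The part of an operator that acts on the data qubits `q`. -/
def onData {q a : Type*} (u : Pauli (q ⊕ a)) : Pauli q := fun i => u (Sum.inl i)

/-- The part of an operator that acts on the auxiliary qubits `a`. -/
def onAux {q a : Type*} (u : Pauli (q ⊕ a)) : Pauli a := fun i => u (Sum.inr i)

/-- An operator on the data qubits, extended by the identity to the auxiliary qubits. -/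
def ofData {q a : Type*} (u : Pauli q) : Pauli (q ⊕ a) := Sum.elim u (fun _ => 0)

end Pauli

/-! ### Stabiliser codes -/

/-- A qubit stabiliser code given by pairwise commuting checks (redundant checks are allowed). -/
structure StabilizerCode (q r : Type*) [Fintype q] where
  check : r → Pauli q
  check_comm : ∀ i j, Pauli.symp (check i) (check j) = 0

namespace StabilizerCode

variable {q r : Type*} [Fintype q]

/-- The stabiliser group. -/
def stabilizers (Q : StabilizerCode q r) : Submodule (ZMod 2) (Pauli q) :=
  Submodule.span (ZMod 2) (Set.range Q.check)

/-- Logical operator representatives: operators that commute with every check. -/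
def IsLogical (Q : StabilizerCode q r) (u : Pauli q) : Prop :=
  ∀ i, Pauli.symp (Q.check i) u = 0

/-- Two representatives are equivalent if they differ by a stabiliser. -/
def Equivalent (Q : StabilizerCode q r) (u v : Pauli q) : Prop := u - v ∈ Q.stabilizers

/-- Number of checks that are violated by the data fault `e`. -/
def syndromeWeight [Fintype r] (Q : StabilizerCode q r) (e : Pauli q) : ℕ :=
  #{i : r | Pauli.symp (Q.check i) e ≠ 0}

/-- `f` flips some element of `S`, and with an element of `S` it flips all elements of `S` in the
same equivalence class. -/
def FlipsClasses (Q : StabilizerCode q r) (S : Set (Pauli q)) (f : Pauli q) : Prop :=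
  (∃ u ∈ S, Pauli.Flips f u) ∧
    ∀ u ∈ S, Pauli.Flips f u → ∀ v ∈ S, Q.Equivalent u v → Pauli.Flips f v

/-- `f` is a data fault of lowest weight among those with `FlipsClasses`. -/
def IsLowestFlip (Q : StabilizerCode q r) (S : Set (Pauli q)) (f : Pauli q) : Prop :=
  Q.FlipsClasses S f ∧ ∀ g : Pauli q, Q.FlipsClasses S g → Pauli.weight f ≤ Pauli.weight g

/-- The outcomes of measuring `S` on an arbitrary code state are not known in advance.
The outcome of a product of elements of `S` is determined by the code exactly when that product is
a stabiliser. Representatives of the same class always have equal outcomes; the requirement is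
that nothing else is determined: each stabiliser that is a product of elements of `S` is a product
of factors `u * v` with `u, v ∈ S` equivalent. -/
def OutcomesUnknown (Q : StabilizerCode q r) (S : Set (Pauli q)) : Prop :=
  ∀ g ∈ Submodule.span (ZMod 2) S, g ∈ Q.stabilizers →
    g ∈ Submodule.span (ZMod 2) {p : Pauli q | ∃ u ∈ S, ∃ v ∈ S, Q.Equivalent u v ∧ p = u - v}

end StabilizerCode

/-! ### Clifford circuits with Pauli measurements, and phenomenological faults -/

/-- A circuit on the qubits `ι` with measurement outcomes labelled by `x`. Step `t < steps` applies
the Clifford gate `gate t` (through its symplectic action on Paulis modulo phase) and then measures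
the pairwise commuting Pauli operators `op y` with `time y = t`. -/
structure CliffordCircuit (ι x : Type*) [Fintype ι] where
  steps : ℕ
  gate : ℕ → (Pauli ι ≃ₗ[ZMod 2] Pauli ι)
  gate_symp : ∀ t u v, Pauli.symp (gate t u) (gate t v) = Pauli.symp u v
  time : x → ℕ
  time_lt : ∀ y, time y < steps
  op : x → Pauli ι
  op_comm : ∀ y z, time y = time z → Pauli.symp (op y) (op z) = 0

/-- A phenomenological fault: a Pauli error `data t` on the qubits just before step `t`
(`data steps` being the error after the last step), and flips of recorded measurement outcomes. -/
structure Fault (ι x : Type*) where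
  data : ℕ → Pauli ι
  meas : x → ZMod 2

namespace CliffordCircuit

variable {ι x : Type*} [Fintype ι]

/-- The product of the first `t` gates. -/
def frame (C : CliffordCircuit ι x) : ℕ → (Pauli ι ≃ₗ[ZMod 2] Pauli ι)
  | 0 => LinearEquiv.refl (ZMod 2) (Pauli ι)
  | t + 1 => (C.frame t).trans (C.gate t)

/-- A measured operator, pulled back through the gates to the input of the circuit. -/
def pullback (C : CliffordCircuit ι x) (y : x) : Pauli ι :=
  (C.frame (C.time y + 1)).symm (C.op y)

/-- The accumulated error just before step `t` (including the error that occurs there). -/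
def error (C : CliffordCircuit ι x) (F : Fault ι x) : ℕ → Pauli ι
  | 0 => F.data 0
  | t + 1 => C.gate t (C.error F t) + F.data (t + 1)

/-- Whether the recorded outcome `y` is flipped by the fault. -/
def outcomeFlip (C : CliffordCircuit ι x) (F : Fault ι x) (y : x) : ZMod 2 :=
  Pauli.symp (C.op y) (C.gate (C.time y) (C.error F (C.time y))) + F.meas y

/-- Number of single-qubit Pauli errors (over all times) plus number of flipped outcomes. -/
def faultWeight [Fintype x] (C : CliffordCircuit ι x) (F : Fault ι x) : ℕ :=
  (∑ t ∈ range (C.steps + 1), Pauli.weight (F.data t)) + #{y : x | F.meas y ≠ 0}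

/-- The operator at the input whose value equals (up to a fixed sign) the product of the
outcomes in `E` and of the operator `out` at the output, when `(E, out)` is a flow. -/
def inputOp [Fintype x] (C : CliffordCircuit ι x) (E : x → ZMod 2) (out : Pauli ι) : Pauli ι :=
  (C.frame C.steps).symm out + ∑ y, E y • C.pullback y

/-- `(E, out)` is a (stabiliser) flow: propagating `out` backwards and multiplying in the measured
operators selected by `E` gives, at each step, an operator that commutes with
all operators measured there. -/
def IsFlow [Fintype x] (C : CliffordCircuit ι x) (E : x → ZMod 2) (out : Pauli ι) : Prop :=
  ∀ z : x, Pauli.symp (C.pullback z)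
    ((C.frame C.steps).symm out + ∑ y with C.time z < C.time y, E y • C.pullback y) = 0

/-- Whether the fault flips the product of the outcomes in `E` and of `out` at the output. -/
def flowFlip [Fintype x] (C : CliffordCircuit ι x) (F : Fault ι x) (E : x → ZMod 2)
    (out : Pauli ι) : ZMod 2 :=
  (∑ y, E y * C.outcomeFlip F y) + Pauli.symp out (C.error F C.steps)

end CliffordCircuit

/-! ### Measurement by auxiliary systems -/

/-- A protocol on the data qubits of `Q` and auxiliary qubits `a`, with `R` rounds of
syndrome measurement (each records one outcome per check of `Q`) and further outcomes, labelled by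
`m`, of the auxiliary systems. The auxiliary systems act during the steps `tBegin ≤ t < tEnd`;
before and after, `Q` idles, with any number of ordinary syndrome rounds.

While the auxiliary systems act, checks of `Q` may be deformed onto auxiliary qubits, arbitrary
Paulis on data and auxiliary qubits may be measured, and Clifford gates may couple the two
(for instance, to copy data errors to an ancilla block), but `Q` remains in place:
its data errors are not moved or transformed, and the check `i` of each syndrome round acts on the
data qubits as check `i` of `Q`. -/
structure AuxProtocol {q r : Type*} [Fintype q] (Q : StabilizerCode q r) (a m : Type*) [Fintype a]
    (R : ℕ) extends CliffordCircuit (q ⊕ a) ((Fin R × r) ⊕ m) where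
  /-- Stabilisers of the initial state of the auxiliary qubits. -/
  auxInit : Submodule (ZMod 2) (Pauli a)
  auxInit_comm : ∀ u ∈ auxInit, ∀ v ∈ auxInit, Pauli.symp u v = 0
  tBegin : ℕ
  tEnd : ℕ
  tBegin_le_tEnd : tBegin ≤ tEnd
  tEnd_le_steps : tEnd ≤ steps
  roundTime : Fin R → ℕ
  roundTime_strictMono : StrictMono roundTime
  time_check : ∀ k i, time (Sum.inl (k, i)) = roundTime k
  time_aux : ∀ y : m, tBegin ≤ time (Sum.inr y) ∧ time (Sum.inr y) < tEnd
  gate_idle : ∀ t, t < tBegin ∨ tEnd ≤ t → gate t = LinearEquiv.refl (ZMod 2) (Pauli (q ⊕ a))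
  check_idle : ∀ k i, roundTime k < tBegin ∨ tEnd ≤ roundTime k →
    op (Sum.inl (k, i)) = Pauli.ofData (Q.check i)
  check_active : ∀ k i, tBegin ≤ roundTime k → roundTime k < tEnd →
    Pauli.onData (toCliffordCircuit.pullback (Sum.inl (k, i))) = Q.check i
  data_fixed : ∀ (t : ℕ) (e : Pauli q),
    Pauli.onData (toCliffordCircuit.frame t (Pauli.ofData e)) = e

namespace AuxProtocol

variable {q r a m : Type*} [Fintype q] [Fintype r] [Fintype a] [Fintype m]
  {Q : StabilizerCode q r} {R : ℕ}

/-- Number of syndrome rounds while the auxiliary systems act. -/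
def activeRounds (P : AuxProtocol Q a m R) : ℕ :=
  #{k : Fin R | P.tBegin ≤ P.roundTime k ∧ P.roundTime k < P.tEnd}

/-- A detector: a product of outcomes, possibly with a stabiliser of `Q` at the output (which is
available from the subsequent memory), whose value is determined because
it equals a stabiliser of the input state. -/
def IsDetector (P : AuxProtocol Q a m R) (E : (Fin R × r) ⊕ m → ZMod 2) (g : Pauli q) : Prop :=
  P.IsFlow E (Pauli.ofData g) ∧ g ∈ Q.stabilizers ∧
    Pauli.onData (P.inputOp E (Pauli.ofData g)) ∈ Q.stabilizers ∧
    Pauli.onAux (P.inputOp E (Pauli.ofData g)) ∈ P.auxInit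

/-- A logical observable: a product of outcomes and of a logical operator at the output that equals
a logical operator of the input code state. For `g = 0` it is a logical measurement
outcome; in general it describes the action of the protocol on the logical qubits. -/
def IsObservable (P : AuxProtocol Q a m R) (E : (Fin R × r) ⊕ m → ZMod 2) (g : Pauli q) : Prop :=
  P.IsFlow E (Pauli.ofData g) ∧ Q.IsLogical g ∧
    Q.IsLogical (Pauli.onData (P.inputOp E (Pauli.ofData g))) ∧
    Pauli.onAux (P.inputOp E (Pauli.ofData g)) ∈ P.auxInit

/-- A logical fault flips no detector, but flips some logical observable. -/
def IsLogicalFault (P : AuxProtocol Q a m R) (F : Fault (q ⊕ a) ((Fin R × r) ⊕ m)) : Prop :=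
  (∀ E g, P.IsDetector E g → P.flowFlip F E (Pauli.ofData g) = 0) ∧
    ∃ E g, P.IsObservable E g ∧ P.flowFlip F E (Pauli.ofData g) = 1

/-- The phenomenological fault distance: the least weight of a logical fault (`⊤` if there is
none). -/
noncomputable def faultDistance (P : AuxProtocol Q a m R) : ℕ∞ :=
  ⨅ (F : Fault (q ⊕ a) ((Fin R × r) ⊕ m)) (_ : P.IsLogicalFault F), (P.faultWeight F : ℕ∞)

/-- The representatives that the auxiliary systems measure: a product of outcomes yields the value
of a logical operator of the input, up to stabilisers of `Q` that are known from the syndrome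
rounds and at the output; the representative is the product of the data parts of
the auxiliary measurements that enter it. -/
def measured (P : AuxProtocol Q a m R) : Set (Pauli q) :=
  {p | ∃ (E : (Fin R × r) ⊕ m → ZMod 2) (g : Pauli q),
    P.IsFlow E (Pauli.ofData g) ∧ g ∈ Q.stabilizers ∧
    Q.IsLogical (Pauli.onData (P.inputOp E (Pauli.ofData g))) ∧
    Pauli.onAux (P.inputOp E (Pauli.ofData g)) ∈ P.auxInit ∧
    p = ∑ y : m, E (Sum.inr y) • Pauli.onData (P.pullback (Sum.inr y))}

/-- The auxiliary systems measure the representatives in `S` (hence their products), and no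
others. -/
def Measures (P : AuxProtocol Q a m R) (S : Set (Pauli q)) : Prop :=
  P.measured = (Submodule.span (ZMod 2) S : Set (Pauli q))

end AuxProtocol

/-! Spread the data fault `f` over a window: it occurs just before the auxiliary systems act and
again just after, and every check outcome in between that it violates is flipped. This costs
`2 w + T s`. No check outcome changes, and the two copies of `f` cancel at the output, so
only the auxiliary outcomes notice `f`: a product of outcomes is flipped iff `f` anticommutes with
its measured representative. For a detector that representative is a stabiliser and a product of
elements of `S`, hence a product of factors `u v` with `u, v ∈ S` equivalent, all of which commute
with `f`; an element of `S` that anticommutes with `f` is a flipped observable. -/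

namespace Pauli

section Symp

variable {ι : Type*} [Fintype ι]

lemma symp_comm (u v : Pauli ι) : symp u v = symp v u :=
  sum_congr rfl fun _ _ => by ring

lemma symp_add_left (u v w : Pauli ι) : symp (u + v) w = symp u w + symp v w := by
  simp only [symp, ← sum_add_distrib, Pi.add_apply, Prod.fst_add, Prod.snd_add]
  exact sum_congr rfl fun _ _ => by ring

lemma symp_smul_left (c : ZMod 2) (u v : Pauli ι) : symp (c • u) v = c * symp u v := by
  simp only [symp, mul_sum, Pi.smul_apply, Prod.smul_fst, Prod.smul_snd, smul_eq_mul]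
  exact sum_congr rfl fun _ _ => by ring

/-- The symplectic form `symp` as a bilinear form, giving access to the library's linear algebra. -/
def sympForm : LinearMap.BilinForm (ZMod 2) (Pauli ι) :=
  LinearMap.mk₂ (ZMod 2) symp symp_add_left symp_smul_left
    (fun u v w => by rw [symp_comm, symp_add_left, symp_comm v, symp_comm w])
    (fun c u v => by rw [symp_comm, symp_smul_left, symp_comm v, smul_eq_mul])

lemma symp_zero_right (u : Pauli ι) : symp u 0 = 0 :=
  map_zero (sympForm u)

lemma symp_add_right (u v w : Pauli ι) : symp u (v + w) = symp u v + symp u w :=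
  map_add (sympForm u) v w

lemma symp_sub_left (u v w : Pauli ι) : symp (u - v) w = symp u w - symp v w :=
  map_sub (sympForm.flip w) u v

lemma symp_sum_left {κ : Type*} (s : Finset κ) (u : κ → Pauli ι) (v : Pauli ι) :
    symp (∑ y ∈ s, u y) v = ∑ y ∈ s, symp (u y) v :=
  map_sum (sympForm.flip v) u s

lemma symp_eq_zero_of_mem_span {s : Set (Pauli ι)} {u v : Pauli ι} (hs : ∀ w ∈ s, symp w v = 0)
    (hu : u ∈ Submodule.span (ZMod 2) s) : symp u v = 0 :=
  (Submodule.span_le (p := LinearMap.ker (sympForm.flip v))).2 hs hu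

lemma symp_single_right [DecidableEq ι] (u : Pauli ι) (i : ι) (c : ZMod 2 × ZMod 2) :
    symp u (Pi.single i c) = (u i).1 * c.2 + (u i).2 * c.1 := by
  unfold symp
  rw [Fintype.sum_eq_single i fun j hj => by simp [Pi.single_eq_of_ne hj], Pi.single_eq_same]

lemma symp_injective : Function.Injective (symp : Pauli ι → Pauli ι → ZMod 2) := by
  classical
  intro u v h
  funext i
  have hX := congrFun h (Pi.single i (1, 0))
  have hZ := congrFun h (Pi.single i (0, 1))
  simp only [symp_single_right, mul_zero, mul_one, zero_add, add_zero] at hX hZ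
  exact Prod.ext hZ hX

lemma weight_zero : weight (0 : Pauli ι) = 0 := hammingNorm_zero

lemma weight_add_le (u v : Pauli ι) : weight (u + v) ≤ weight u + weight v := by
  simpa only [weight, hammingDist_eq_hammingNorm, neg_neg, neg_zero, zero_add, add_zero]
    using hammingDist_triangle (-u) 0 v

lemma sum_weight_single_le {τ : Type*} [DecidableEq τ] (s : Finset τ) (t : τ) (u : Pauli ι) :
    ∑ i ∈ s, weight ((Pi.single t u : τ → Pauli ι) i) ≤ weight u := by
  simp only [Pi.apply_single (fun _ => weight) (fun _ => weight_zero) t u, sum_pi_single']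
  split_ifs <;> simp

end Symp

section Data

variable {q a : Type*}

lemma onData_add (u v : Pauli (q ⊕ a)) : onData (u + v) = onData u + onData v := rfl

lemma onData_smul (c : ZMod 2) (u : Pauli (q ⊕ a)) : onData (c • u) = c • onData u := rfl

lemma onData_sum {κ : Type*} (s : Finset κ) (u : κ → Pauli (q ⊕ a)) :
    onData (∑ y ∈ s, u y) = ∑ y ∈ s, onData (u y) :=
  map_sum (LinearMap.funLeft (ZMod 2) (ZMod 2 × ZMod 2) Sum.inl) u s

variable [Fintype q] [Fintype a]

lemma symp_ofData_right (u : Pauli (q ⊕ a)) (e : Pauli q) :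
    symp u (ofData e) = symp (onData u) e := by
  simp [symp, ofData, onData]

lemma symp_ofData_left (e : Pauli q) (u : Pauli (q ⊕ a)) :
    symp (ofData e) u = symp e (onData u) := by
  rw [symp_comm, symp_ofData_right, symp_comm]

lemma weight_ofData (e : Pauli q) : weight (ofData e : Pauli (q ⊕ a)) = weight e := by
  have filter_eq : ({i | ofData e i ≠ 0} : Finset (q ⊕ a)) = disjSum {i | e i ≠ 0} ∅ := by
    ext (i | i) <;> rw [mem_filter_univ] <;> simp [ofData]
  simp only [weight, hammingNorm, filter_eq, card_disjSum, card_empty, add_zero]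

end Data

end Pauli

namespace StabilizerCode

open Pauli

variable {q r : Type*} [Fintype q] {Q : StabilizerCode q r} {S : Set (Pauli q)} {f g u v : Pauli q}

lemma isLogical_of_mem_stabilizers (hg : g ∈ Q.stabilizers) : Q.IsLogical g := by
  intro i
  rw [symp_comm]
  refine symp_eq_zero_of_mem_span ?_ hg
  rintro _ ⟨j, rfl⟩
  exact Q.check_comm j i

lemma Equivalent.symm (h : Q.Equivalent u v) : Q.Equivalent v u := by
  simpa only [Equivalent, neg_sub] using neg_mem h

lemma FlipsClasses.symp_eq_of_equivalent (hf : Q.FlipsClasses S f) (hu : u ∈ S) (hv : v ∈ S)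
    (huv : Q.Equivalent u v) : symp u f = symp v f := by
  have hflips : Flips f u ↔ Flips f v :=
    ⟨fun h => hf.2 u hu h v hv huv, fun h => hf.2 v hv h u hu huv.symm⟩
  have eq_of_eq_one_iff : ∀ c d : ZMod 2, (c = 1 ↔ d = 1) → c = d := by decide
  rw [symp_comm u, symp_comm v]
  exact eq_of_eq_one_iff _ _ hflips

lemma FlipsClasses.symp_eq_zero (hf : Q.FlipsClasses S f) (hS : Q.OutcomesUnknown S)
    (hg : g ∈ Submodule.span (ZMod 2) S) (hgQ : g ∈ Q.stabilizers) : symp g f = 0 := by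
  refine symp_eq_zero_of_mem_span ?_ (hS g hg hgQ)
  rintro _ ⟨u, hu, v, hv, huv, rfl⟩
  rw [symp_sub_left, hf.symp_eq_of_equivalent hu hv huv, sub_self]

end StabilizerCode

namespace CliffordCircuit

open Pauli

variable {ι x : Type*} [Fintype ι] (C : CliffordCircuit ι x)

lemma symp_frame (t : ℕ) (u v : Pauli ι) : symp (C.frame t u) (C.frame t v) = symp u v := by
  induction t with
  | zero => rfl
  | succ t ih => exact (C.gate_symp t _ _).trans ih

lemma symp_frame_symm_left (t : ℕ) (u v : Pauli ι) :
    symp ((C.frame t).symm u) v = symp u (C.frame t v) := by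
  rw [← C.symp_frame t, LinearEquiv.apply_symm_apply]

/-- The accumulated error before step `t`, pulled back to the input. In this picture the gates
disappear: errors of different times simply add up. -/
def inputError (F : Fault ι x) (t : ℕ) : Pauli ι :=
  ∑ i ∈ range (t + 1), (C.frame i).symm (F.data i)

lemma frame_inputError (F : Fault ι x) (t : ℕ) : C.frame t (C.inputError F t) = C.error F t := by
  induction t with
  | zero => simp [inputError, frame, error]
  | succ t ih =>
    rw [inputError, sum_range_succ, ← inputError, map_add, LinearEquiv.apply_symm_apply, error,
      ← ih]
    rfl

lemma outcomeFlip_eq_symp_inputError (F : Fault ι x) (y : x) :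
    C.outcomeFlip F y = symp (C.pullback y) (C.inputError F (C.time y)) + F.meas y := by
  rw [outcomeFlip, pullback, symp_frame_symm_left, ← frame_inputError]
  rfl

end CliffordCircuit

namespace AuxProtocol

open Pauli CliffordCircuit

variable {q r a m : Type*} [Fintype q] [Fintype a] {Q : StabilizerCode q r} {R : ℕ}
  (P : AuxProtocol Q a m R)

lemma frame_of_le_tBegin {t : ℕ} (ht : t ≤ P.tBegin) :
    P.frame t = LinearEquiv.refl (ZMod 2) (Pauli (q ⊕ a)) := by
  induction t with
  | zero => rfl
  | succ t ih =>
    rw [frame, ih (Nat.le_of_succ_le ht), P.gate_idle t (Or.inl ht)]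
    rfl

lemma frame_of_tEnd_le {t : ℕ} (ht : P.tEnd ≤ t) : P.frame t = P.frame P.tEnd := by
  induction t, ht using Nat.le_induction with
  | base => rfl
  | succ t ht ih =>
    rw [frame, ih, P.gate_idle t (Or.inr ht)]
    rfl

lemma onData_frame_symm_ofData (t : ℕ) (g : Pauli q) :
    onData ((P.frame t).symm (ofData g)) = g := by
  refine symp_injective (funext fun e => ?_)
  rw [← symp_ofData_right, symp_frame_symm_left, symp_ofData_left, P.data_fixed]

lemma onData_pullback_check (k : Fin R) (i : r) :
    onData (P.pullback (Sum.inl (k, i))) = Q.check i := by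
  by_cases hk : P.tBegin ≤ P.roundTime k ∧ P.roundTime k < P.tEnd
  · exact P.check_active k i hk.1 hk.2
  · rw [pullback, P.check_idle k i (by omega), onData_frame_symm_ofData]

/-- The data fault `f` at the beginning and at the end of the window in which the auxiliary systems
act, together with flips of all check outcomes in the window that `f` violates. -/
def windowFault (f : Pauli q) : Fault (q ⊕ a) ((Fin R × r) ⊕ m) where
  data := Pi.single P.tBegin (ofData f) + Pi.single P.tEnd (ofData f)
  meas := Sum.elim
    (fun p => if P.tBegin ≤ P.roundTime p.1 ∧ P.roundTime p.1 < P.tEnd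
      then symp (Q.check p.2) f else 0)
    0

lemma inputError_windowFault (f : Pauli q) (t : ℕ) :
    P.inputError (P.windowFault f) t =
      (if P.tBegin ≤ t then ofData f else 0) +
        (if P.tEnd ≤ t then (P.frame P.tEnd).symm (ofData f) else 0) := by
  have frame_symm_single (b i : ℕ) :
      (P.frame i).symm ((Pi.single b (ofData f) : ℕ → Pauli (q ⊕ a)) i) =
        (Pi.single b ((P.frame b).symm (ofData f)) : ℕ → Pauli (q ⊕ a)) i :=
    Pi.apply_single (fun i => (P.frame i).symm) (fun _ => map_zero _) b _ i
  simp only [inputError, windowFault, Pi.add_apply, map_add, frame_symm_single, sum_add_distrib,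
    sum_pi_single', mem_range, Nat.lt_succ_iff, P.frame_of_le_tBegin le_rfl, LinearEquiv.refl_symm,
    LinearEquiv.refl_apply]

lemma inputError_windowFault_of_lt_tBegin (f : Pauli q) {t : ℕ} (ht : t < P.tBegin) :
    P.inputError (P.windowFault f) t = 0 := by
  rw [inputError_windowFault, if_neg ht.not_ge, if_neg (ht.trans_le P.tBegin_le_tEnd).not_ge,
    add_zero]

lemma inputError_windowFault_of_active (f : Pauli q) {t : ℕ} (hBegin : P.tBegin ≤ t)
    (hEnd : t < P.tEnd) : P.inputError (P.windowFault f) t = ofData f := by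
  rw [inputError_windowFault, if_pos hBegin, if_neg hEnd.not_ge, add_zero]

lemma symp_frame_symm_ofData_inputError_windowFault (f g : Pauli q) {t u : ℕ} (ht : P.tEnd ≤ t)
    (hu : P.tEnd ≤ u) :
    symp ((P.frame t).symm (ofData g)) (P.inputError (P.windowFault f) u) = 0 := by
  rw [inputError_windowFault, if_pos (P.tBegin_le_tEnd.trans hu), if_pos hu, symp_add_right,
    symp_ofData_right, onData_frame_symm_ofData, P.frame_of_tEnd_le ht, symp_frame_symm_left,
    LinearEquiv.apply_symm_apply, symp_ofData_right]
  exact CharTwo.add_self_eq_zero (symp g f)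

lemma outcomeFlip_windowFault_check (f : Pauli q) (k : Fin R) (i : r) :
    P.outcomeFlip (P.windowFault f) (Sum.inl (k, i)) = 0 := by
  rw [outcomeFlip_eq_symp_inputError, P.time_check]
  by_cases hk : P.tBegin ≤ P.roundTime k ∧ P.roundTime k < P.tEnd
  · rw [P.inputError_windowFault_of_active f hk.1 hk.2, symp_ofData_right, onData_pullback_check]
    simp only [windowFault, Sum.elim_inl, if_pos hk]
    exact CharTwo.add_self_eq_zero _
  · have meas_eq_zero : (P.windowFault f).meas (Sum.inl (k, i)) = 0 := if_neg hk
    rw [meas_eq_zero, add_zero]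
    obtain hBefore | hAfter : P.roundTime k < P.tBegin ∨ P.tEnd ≤ P.roundTime k := by omega
    · rw [P.inputError_windowFault_of_lt_tBegin f hBefore, symp_zero_right]
    · rw [pullback, P.check_idle k i (Or.inr hAfter), P.time_check]
      exact P.symp_frame_symm_ofData_inputError_windowFault f _ (Nat.le_succ_of_le hAfter) hAfter

lemma outcomeFlip_windowFault_aux (f : Pauli q) (y : m) :
    P.outcomeFlip (P.windowFault f) (Sum.inr y) = symp (onData (P.pullback (Sum.inr y))) f := by
  have meas_eq_zero : (P.windowFault f).meas (Sum.inr y) = 0 := rfl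
  rw [outcomeFlip_eq_symp_inputError,
    P.inputError_windowFault_of_active f (P.time_aux y).1 (P.time_aux y).2, symp_ofData_right,
    meas_eq_zero, add_zero]

lemma sum_weight_windowFault_le (f : Pauli q) (s : Finset ℕ) :
    ∑ t ∈ s, weight ((P.windowFault f).data t) ≤ 2 * weight f :=
  calc ∑ t ∈ s, weight ((P.windowFault f).data t)
      ≤ ∑ t ∈ s, (weight ((Pi.single P.tBegin (ofData f) : ℕ → Pauli (q ⊕ a)) t) +
          weight ((Pi.single P.tEnd (ofData f) : ℕ → Pauli (q ⊕ a)) t)) :=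
        sum_le_sum fun _ _ => weight_add_le _ _
    _ ≤ weight (ofData f : Pauli (q ⊕ a)) + weight (ofData f : Pauli (q ⊕ a)) := by
        rw [sum_add_distrib]
        exact add_le_add (sum_weight_single_le _ _ _) (sum_weight_single_le _ _ _)
    _ = 2 * weight f := by rw [weight_ofData, two_mul]

variable [Fintype m]

/-- The product of the data parts of the auxiliary measurements selected by `E`, pulled back to the
input; the elements of `P.measured` are of this form. -/
def representative (E : (Fin R × r) ⊕ m → ZMod 2) : Pauli q :=
  ∑ y : m, E (Sum.inr y) • onData (P.pullback (Sum.inr y))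

variable [Fintype r]

lemma card_meas_windowFault (f : Pauli q) :
    #{y | (P.windowFault f).meas y ≠ 0} = P.activeRounds * Q.syndromeWeight f := by
  have flipped_eq : ({y | (P.windowFault f).meas y ≠ 0} : Finset ((Fin R × r) ⊕ m)) =
      disjSum (univ.filter (fun k => P.tBegin ≤ P.roundTime k ∧ P.roundTime k < P.tEnd) ×ˢ
        univ.filter (fun i => symp (Q.check i) f ≠ 0)) ∅ := by
    ext (⟨k, i⟩ | y) <;> rw [mem_filter_univ] <;> simp [windowFault, and_assoc]
  rw [flipped_eq, card_disjSum, card_product, card_empty, add_zero, activeRounds,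
    StabilizerCode.syndromeWeight]

lemma faultWeight_windowFault_le (f : Pauli q) :
    P.faultWeight (P.windowFault f) ≤ 2 * weight f + P.activeRounds * Q.syndromeWeight f :=
  add_le_add (P.sum_weight_windowFault_le f _) (P.card_meas_windowFault f).le

lemma flowFlip_windowFault (f g : Pauli q) (E : (Fin R × r) ⊕ m → ZMod 2) :
    P.flowFlip (P.windowFault f) E (ofData g) = symp (P.representative E) f := by
  have output_unflipped : symp (ofData g) (P.error (P.windowFault f) P.steps) = 0 := by
    rw [← frame_inputError, ← symp_frame_symm_left]
    exact P.symp_frame_symm_ofData_inputError_windowFault f g P.tEnd_le_steps P.tEnd_le_steps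
  simp only [flowFlip, output_unflipped, Fintype.sum_sum_type, Fintype.sum_prod_type,
    outcomeFlip_windowFault_check, outcomeFlip_windowFault_aux, representative, symp_sum_left,
    symp_smul_left, mul_zero, sum_const_zero, zero_add, add_zero]

lemma onData_inputOp (E : (Fin R × r) ⊕ m → ZMod 2) (g : Pauli q) :
    onData (P.inputOp E (ofData g)) =
      g + ((∑ p : Fin R × r, E (Sum.inl p) • Q.check p.2) + P.representative E) := by
  simp only [inputOp, representative, onData_add, onData_sum, onData_smul,
    onData_frame_symm_ofData, Fintype.sum_sum_type, Fintype.sum_prod_type, onData_pullback_check]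

lemma representative_mem_stabilizers {E : (Fin R × r) ⊕ m → ZMod 2} {g : Pauli q}
    (hg : g ∈ Q.stabilizers) (hin : onData (P.inputOp E (ofData g)) ∈ Q.stabilizers) :
    P.representative E ∈ Q.stabilizers := by
  have checks_mem : ∑ p : Fin R × r, E (Sum.inl p) • Q.check p.2 ∈ Q.stabilizers :=
    sum_mem fun p _ => Submodule.smul_mem _ _ (Submodule.subset_span ⟨p.2, rfl⟩)
  rwa [onData_inputOp, Submodule.add_mem_iff_right _ hg,
    Submodule.add_mem_iff_right _ checks_mem] at hin

lemma isLogicalFault_windowFault {f : Pauli q}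
    (hcomm : ∀ p ∈ P.measured, p ∈ Q.stabilizers → symp p f = 0)
    (hflips : ∃ p ∈ P.measured, Flips f p) : P.IsLogicalFault (P.windowFault f) := by
  constructor
  · rintro E g ⟨hflow, hg, hdata, haux⟩
    rw [flowFlip_windowFault]
    exact hcomm _
      ⟨E, g, hflow, hg, StabilizerCode.isLogical_of_mem_stabilizers hdata, haux, rfl⟩
      (P.representative_mem_stabilizers hg hdata)
  · obtain ⟨_, ⟨E, g, hflow, hg, hdata, haux, rfl⟩, hfp⟩ := hflips
    refine ⟨E, g, ⟨hflow, StabilizerCode.isLogical_of_mem_stabilizers hg, hdata, haux⟩, ?_⟩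
    rw [flowFlip_windowFault, symp_comm]
    exact hfp

end AuxProtocol

theorem mainTheorem7_general {q r a m : Type*} [Fintype q] [Fintype r] [Fintype a] [Fintype m]
    {Q : StabilizerCode q r} {R : ℕ} (P : AuxProtocol Q a m R) {S : Set (Pauli q)}
    (hmeas : P.Measures S) (hunknown : Q.OutcomesUnknown S) {f : Pauli q}
    (hf : Q.FlipsClasses S f) :
    P.faultDistance ≤
      ((2 * Pauli.weight f + P.activeRounds * Q.syndromeWeight f : ℕ) : ℕ∞) := by
  have measured_eq : P.measured = Submodule.span (ZMod 2) S := hmeas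
  have hlogical : P.IsLogicalFault (P.windowFault f) := by
    refine P.isLogicalFault_windowFault ?_ ?_ <;> rw [measured_eq]
    · exact fun p hp hpQ => hf.symp_eq_zero hunknown hp hpQ
    · obtain ⟨u, hu, hfu⟩ := hf.1
      exact ⟨u, Submodule.subset_span hu, hfu⟩
  exact (iInf₂_le _ hlogical).trans (Nat.cast_le.2 (P.faultWeight_windowFault_le f))

theorem mainTheorem7 {q r a m : Type*} [Fintype q] [Fintype r] [Fintype a] [Fintype m]
    (Q : StabilizerCode q r) (R : ℕ) (P : AuxProtocol Q a m R)
    (S : Set (Pauli q)) (hlog : ∀ u ∈ S, Q.IsLogical u)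
    (hmeas : P.Measures S) (hunknown : Q.OutcomesUnknown S)
    (f : Pauli q) (hf : Q.IsLowestFlip S f)
    (w s T : ℕ) (hw : w = Pauli.weight f) (hs : s = Q.syndromeWeight f)
    (hT : T = P.activeRounds) :
    P.faultDistance ≤ ((2 * w + T * s : ℕ) : ℕ∞) := by
  subst hw hs hT
  exact mainTheorem7_general P hmeas hunknown hf.1
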